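/- Let $n\ge 2$ and let $\mathcal O_n$ be the Cuntz algebra, i.e. the universal unital C*-algebra generated by $s_1,\dots,s_n$ subject to $s_i^*s_j=\delta_{ij}1$ and $\sum_{i=1}^n s_is_i^*=1$. Let $A=\mathcal O_n^{\mathbb T}\cong M_{n^\infty}$ be the fixed-point algebra of the gauge action $s_i\mapsto zs_i$ ($z\in\mathbb T$). For $a\in A$ put $$\lambda(a)=\sum_{i=1}^n s_ias_i^*,\qquad \mathcal E(a)=\sum_{i=1}^n s_is_i^*\,a\,s_is_i^*,\qquad \mathcal L(a)=\sum_{i=1}^n s_i^*as_i .$$ Let ${}_\lambda A_A$ be the space $A$ with left action $a\rhd\xi=\lambda(a)\xi$, right action $\xi\lhd a=\xi a$, left inner product ${}_A\langle\eta,\xi\rangle=\mathcal L(\mathcal E(\eta\xi^*))$ and right inner product $\langle\eta\mid\xi\rangle_A=\eta^*\xi$. Call $X$ a Hilbert $A$-$A$ bimodule if it is a left and a right Hilbert $A$-module (positive definite inner products, complete norms) with commuting unital actions, each action being by adjointable operators for the inner product of the other side, and with equivalent left and right norms. A finite family $(u_i)$ in $X$ is a left Pimsner–Popa basis if $\xi=\sum_i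 {}_A\langle\xi,u_i\rangle\rhd u_i$ for all $\xi\in X$, and a finite family $(v_j)$ is a right Pimsner–Popa basis if $\xi=\sum_j v_j\lhd\langle v_j\mid\xi\rangle_A$ for all $\xi\in X$. A Hilbert $A$-$A$ bimodule is finitely generated projective if it has a finite left and a finite right Pimsner–Popa basis. Its left index is $\ell\text{-}\mathsf{Ind}_W=\sum_i\langle u_i\mid u_i\rangle_A$ for a finite left basis $(u_i)$, its right index is $r\text{-}\mathsf{Ind}_W=\sum_j{}_A\langle v_j,v_j\rangle$ for a finite right basis $(v_j)$ (both independent of the chosen basis), and its Watatani index is $\mathsf{Ind}_W=r\text{-}\mathsf{Ind}_W\cdot\ell\text{-}\mathsf{Ind}_W$. Then ${}_\lambda A_A$ is a finitely generated projective Hilbert $A$-$A$ bimodule, $\{s_is_j^*\}_{i,j=1}^n$ is a left Pimsner–Popa basis, $\{1\}$ is a right Pimsner–Popa basis, $\ell\text{-}\mathsf{Ind}_W({}_\lambda A)=n1=r\text{-}\mathsf{Ind}_W(A_A)$, and $\mathsf{Ind}_W({}_\lambda A_A)=n^21$. -/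

import Mathlib

open scoped ENNReal Topology

noncomputable section

/-! ### The Cuntz algebra, its gauge action and its core -/

/-- The Cuntz relations `s_i^* s_j = δ_{ij} 1` and `∑ s_i s_i^* = 1`. -/
structure IsCuntzFamily {n : ℕ} {C : Type*} [CStarAlgebra C] (s : Fin n → C) : Prop where
  star_mul : ∀ i j, star (s i) * s j = if i = j then 1 else 0
  sum_mul_star : ∑ i, s i * star (s i) = 1

/-- A realization of the Cuntz relations in a nonzero unital C*-algebra. -/
structure CuntzRep (n : ℕ) where
  carrier : Type
  [cstar : CStarAlgebra carrier]
  [nontriv : Nontrivial carrier]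
  gen : Fin n → carrier
  isCuntz : IsCuntzFamily gen

attribute [instance] CuntzRep.cstar CuntzRep.nontriv

/-- The C*-algebra of bounded families of elements, one in each realization of the Cuntz relations,
with pointwise operations and the supremum norm. -/
abbrev CuntzProduct (n : ℕ) : Type 1 := lp (fun R : CuntzRep n => R.carrier) ∞

instance (n : ℕ) : CStarAlgebra (CuntzProduct n) where

theorem IsCuntzFamily.norm_le_one {n : ℕ} {C : Type*} [CStarAlgebra C] [Nontrivial C]
    {s : Fin n → C} (h : IsCuntzFamily s) (i : Fin n) : ‖s i‖ ≤ 1 := by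
  have h1 : ‖s i‖ * ‖s i‖ = 1 := by
    rw [← CStarRing.norm_star_mul_self, h.star_mul, if_pos rfl, norm_one]
  nlinarith [norm_nonneg (s i)]

/-- The tautological generators: the family of the `i`-th generators of all realizations. -/
def cuntzProductGen (n : ℕ) (i : Fin n) : CuntzProduct n :=
  ⟨fun R : CuntzRep n => R.gen i, memℓp_infty ⟨1, by
    rintro _ ⟨R, rfl⟩
    exact R.isCuntz.norm_le_one i⟩⟩

/-- The Cuntz algebra `O_n`, the universal C*-algebra on the Cuntz relations: the closed
*-subalgebra generated by the tautological generators, so that the norm of a noncommutative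
*-polynomial in the generators is the supremum of its norms in all realizations. -/
def cuntzSubalgebra (n : ℕ) : StarSubalgebra ℂ (CuntzProduct n) :=
  (StarAlgebra.adjoin ℂ (Set.range (cuntzProductGen n))).topologicalClosure

instance (n : ℕ) : IsClosed (cuntzSubalgebra n : Set (CuntzProduct n)) :=
  StarSubalgebra.isClosed_topologicalClosure _

/-- The Cuntz algebra `O_n`. -/
abbrev CuntzAlgebra (n : ℕ) : Type 1 := cuntzSubalgebra n

instance (n : ℕ) : CStarAlgebra (CuntzAlgebra n) := StarSubalgebra.cstarAlgebra _

theorem cuntzProductGen_mem (n : ℕ) (i : Fin n) : cuntzProductGen n i ∈ cuntzSubalgebra n :=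
  StarSubalgebra.le_topologicalClosure _ (StarAlgebra.subset_adjoin ℂ _ ⟨i, rfl⟩)

/-- The generating isometries `s_1, …, s_n` of `O_n`. -/
def cuntzGen {n : ℕ} (i : Fin n) : CuntzAlgebra n := ⟨cuntzProductGen n i, cuntzProductGen_mem n i⟩

/-- The *-homomorphism from `O_n` to a given realization of the Cuntz relations. -/
def CuntzRep.eval {n : ℕ} (R : CuntzRep n) : CuntzAlgebra n →⋆ₐ[ℂ] R.carrier where
  toFun x := (x : CuntzProduct n) R
  map_one' := rfl
  map_mul' _ _ := rfl
  map_zero' := rfl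
  map_add' _ _ := rfl
  commutes' _ := rfl
  map_star' _ := rfl

theorem CuntzRep.eval_gen {n : ℕ} (R : CuntzRep n) (i : Fin n) :
    R.eval (cuntzGen i) = R.gen i := rfl

theorem cuntzAlgebra_ext {n : ℕ} {x y : CuntzAlgebra n}
    (h : ∀ R : CuntzRep n, R.eval x = R.eval y) : x = y :=
  Subtype.ext (lp.ext (funext h))

theorem isCuntzFamily_cuntzGen (n : ℕ) : IsCuntzFamily (cuntzGen (n := n)) where
  star_mul i j := cuntzAlgebra_ext fun R => by
    have h := R.isCuntz.star_mul i j
    rw [map_mul, map_star, R.eval_gen, R.eval_gen, h]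
    split_ifs
    · rw [map_one]
    · rw [map_zero]
  sum_mul_star := cuntzAlgebra_ext fun R => by
    simp only [map_sum, map_mul, map_star, R.eval_gen, map_one, R.isCuntz.sum_mul_star]

/-- Two *-homomorphisms out of `O_n` that agree on the generators are equal. -/
theorem cuntzAlgebra_hom_ext {n : ℕ} {C : Type*} [CStarAlgebra C] {φ ψ : CuntzAlgebra n →⋆ₐ[ℂ] C}
    (h : ∀ i, φ (cuntzGen i) = ψ (cuntzGen i)) : φ = ψ := by
  have hc : ∀ χ : CuntzAlgebra n →⋆ₐ[ℂ] C, Continuous χ := fun χ =>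
    AddMonoidHomClass.continuous_of_bound χ 1 (by
      simpa only [one_mul] using NonUnitalStarAlgHom.norm_apply_le χ)
  refine StarAlgHom.ext_topologicalClosure (hc φ) (hc ψ) ?_
  refine StarAlgHom.ext_adjoin (s := Set.range (cuntzProductGen n)) ?_
  rintro ⟨_, hx⟩ ⟨i, rfl⟩
  exact h i

/-- The universal property of `O_n`. (A C*-algebra generated by finitely many elements is separable,
hence has an isomorphic copy in `Type`.) -/
theorem cuntzAlgebra_universal {n : ℕ} {C : Type} [CStarAlgebra C] (t : Fin n → C)
    (ht : IsCuntzFamily t) : ∃! φ : CuntzAlgebra n →⋆ₐ[ℂ] C, ∀ i, φ (cuntzGen i) = t i := by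
  rcases subsingleton_or_nontrivial C with hC | hC
  · exact ⟨{ toFun := fun _ => 0
             map_one' := Subsingleton.elim _ _
             map_mul' := fun _ _ => Subsingleton.elim _ _
             map_zero' := rfl
             map_add' := fun _ _ => Subsingleton.elim _ _
             commutes' := fun _ => Subsingleton.elim _ _
             map_star' := fun _ => Subsingleton.elim _ _ },
      fun _ => Subsingleton.elim _ _, fun ψ _ => StarAlgHom.ext fun _ => Subsingleton.elim _ _⟩
  · let R : CuntzRep n := { carrier := C, gen := t, isCuntz := ht }
    exact ⟨R.eval, fun _ => rfl, fun ψ hψ => cuntzAlgebra_hom_ext hψ⟩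

/-- Multiplication of all the generators of a realization by a complex number of modulus one. -/
def CuntzRep.rotate {n : ℕ} (z : Circle) (R : CuntzRep n) : CuntzRep n where
  carrier := R.carrier
  gen i := (z : ℂ) • R.gen i
  isCuntz :=
    { star_mul := fun i j => by
        have hz : star (z : ℂ) * (z : ℂ) = 1 := by
          rw [Complex.star_def, ← Complex.normSq_eq_conj_mul_self, Circle.normSq_coe]
          simp
        rw [star_smul, smul_mul_smul_comm, hz, one_smul, R.isCuntz.star_mul]
      sum_mul_star := by
        have hz : (z : ℂ) * star (z : ℂ) = 1 := by
          rw [mul_comm, Complex.star_def, ← Complex.normSq_eq_conj_mul_self, Circle.normSq_coe]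
          simp
        rw [← R.isCuntz.sum_mul_star]
        refine Finset.sum_congr rfl fun i _ => ?_
        rw [star_smul, smul_mul_smul_comm, hz, one_smul] }

/-- The coordinate permutation of the product of all realizations given by rotation. -/
def cuntzProductRotate (n : ℕ) (z : Circle) : CuntzProduct n →⋆ₐ[ℂ] CuntzProduct n where
  toFun f := ⟨fun R => f (R.rotate z), memℓp_infty ⟨‖f‖, by
    rintro _ ⟨R, rfl⟩
    exact lp.norm_apply_le_norm ENNReal.top_ne_zero f (R.rotate z)⟩⟩
  map_one' := rfl
  map_mul' _ _ := rfl
  map_zero' := rfl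
  map_add' _ _ := rfl
  commutes' _ := rfl
  map_star' _ := rfl

theorem cuntzProductRotate_gen (n : ℕ) (z : Circle) (i : Fin n) :
    cuntzProductRotate n z (cuntzProductGen n i) = (z : ℂ) • cuntzProductGen n i := rfl

theorem cuntzProductRotate_mem (n : ℕ) (z : Circle) (x : CuntzProduct n)
    (hx : x ∈ cuntzSubalgebra n) : cuntzProductRotate n z x ∈ cuntzSubalgebra n := by
  have hc : Continuous (cuntzProductRotate n z) :=
    AddMonoidHomClass.continuous_of_bound (cuntzProductRotate n z) 1 (by
      simpa only [one_mul] using NonUnitalStarAlgHom.norm_apply_le (cuntzProductRotate n z))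
  have hle : cuntzSubalgebra n ≤ (cuntzSubalgebra n).comap (cuntzProductRotate n z) := by
    refine StarSubalgebra.topologicalClosure_minimal ?_ ?_
    · refine StarAlgebra.adjoin_le ?_
      rintro _ ⟨i, rfl⟩
      change cuntzProductRotate n z (cuntzProductGen n i) ∈ cuntzSubalgebra n
      rw [cuntzProductRotate_gen]
      exact SMulMemClass.smul_mem _ (cuntzProductGen_mem n i)
    · exact (StarSubalgebra.isClosed_topologicalClosure _).preimage hc
  exact hle hx

/-- The gauge action of the circle on `O_n`, determined by `s_i ↦ z s_i`. -/
def cuntzGauge {n : ℕ} (z : Circle) : CuntzAlgebra n →⋆ₐ[ℂ] CuntzAlgebra n :=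
  ((cuntzProductRotate n z).comp (cuntzSubalgebra n).subtype).codRestrict (cuntzSubalgebra n)
    fun x => cuntzProductRotate_mem n z x x.2

theorem cuntzGauge_gen {n : ℕ} (z : Circle) (i : Fin n) :
    cuntzGauge z (cuntzGen i) = (z : ℂ) • cuntzGen i := rfl

/-- The core of the Cuntz algebra: the fixed-point algebra of the gauge action. -/
def cuntzCore (n : ℕ) : StarSubalgebra ℂ (CuntzAlgebra n) where
  carrier := {a | ∀ z : Circle, cuntzGauge z a = a}
  mul_mem' ha hb z := by rw [map_mul, ha z, hb z]
  add_mem' ha hb z := by rw [map_add, ha z, hb z]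
  algebraMap_mem' r z := AlgHomClass.commutes (cuntzGauge z) r
  star_mem' ha z := by rw [map_star, ha z]

theorem mem_cuntzCore {n : ℕ} {a : CuntzAlgebra n} :
    a ∈ cuntzCore n ↔ ∀ z : Circle, cuntzGauge z a = a := Iff.rfl

instance (n : ℕ) : IsClosed (cuntzCore n : Set (CuntzAlgebra n)) := by
  have h : (cuntzCore n : Set (CuntzAlgebra n)) = ⋂ z : Circle, {a | cuntzGauge z a = a} := by
    ext a
    simp [mem_cuntzCore]
  rw [h]
  refine isClosed_iInter fun z => isClosed_eq ?_ continuous_id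
  exact AddMonoidHomClass.continuous_of_bound (cuntzGauge z) 1 (by
    simpa only [one_mul] using NonUnitalStarAlgHom.norm_apply_le (cuntzGauge (n := n) z))

/-- The core `A = O_n^𝕋` as a C*-algebra. -/
abbrev Core (n : ℕ) : Type 1 := cuntzCore n

instance (n : ℕ) : CStarAlgebra (Core n) := StarSubalgebra.cstarAlgebra _

theorem gen_mul_star_gen_mem {n : ℕ} (i j : Fin n) :
    cuntzGen i * star (cuntzGen j) ∈ cuntzCore n := by
  intro z
  have hz : (z : ℂ) * star (z : ℂ) = 1 := by
    rw [mul_comm, Complex.star_def, ← Complex.normSq_eq_conj_mul_self, Circle.normSq_coe]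
    simp
  rw [map_mul, map_star, cuntzGauge_gen, cuntzGauge_gen, star_smul, smul_mul_smul_comm, hz, one_smul]

theorem gen_conj_mem {n : ℕ} (i : Fin n) (a : Core n) :
    cuntzGen i * (a : CuntzAlgebra n) * star (cuntzGen i) ∈ cuntzCore n := by
  intro z
  have hz : (z : ℂ) * star (z : ℂ) = 1 := by
    rw [mul_comm, Complex.star_def, ← Complex.normSq_eq_conj_mul_self, Circle.normSq_coe]
    simp
  rw [map_mul, map_mul, map_star, cuntzGauge_gen, a.2 z, star_smul, smul_mul_assoc,
    smul_mul_smul_comm, hz, one_smul]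

theorem star_gen_conj_mem {n : ℕ} (i : Fin n) (a : Core n) :
    star (cuntzGen i) * (a : CuntzAlgebra n) * cuntzGen i ∈ cuntzCore n := by
  intro z
  have hz : star (z : ℂ) * (z : ℂ) = 1 := by
    rw [Complex.star_def, ← Complex.normSq_eq_conj_mul_self, Circle.normSq_coe]
    simp
  rw [map_mul, map_mul, map_star, cuntzGauge_gen, a.2 z, star_smul, smul_mul_assoc,
    smul_mul_smul_comm, hz, one_smul]

/-- The element `s_i s_j^*` of the core. -/
def coreUnit {n : ℕ} (i j : Fin n) : Core n :=
  ⟨cuntzGen i * star (cuntzGen j), gen_mul_star_gen_mem i j⟩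

/-- The endomorphism `λ(a) = ∑ s_i a s_i^*` of the core. -/
def coreEndo {n : ℕ} (a : Core n) : Core n :=
  ∑ i, ⟨cuntzGen i * (a : CuntzAlgebra n) * star (cuntzGen i), gen_conj_mem i a⟩

/-- The expectation `ℰ(a) = ∑ s_i s_i^* a s_i s_i^*` on the core. -/
def coreExp {n : ℕ} (a : Core n) : Core n :=
  ∑ i, coreUnit i i * a * coreUnit i i

/-- The transfer operator `ℒ(a) = ∑ s_i^* a s_i` on the core. -/
def coreTransfer {n : ℕ} (a : Core n) : Core n :=
  ∑ i, ⟨star (cuntzGen i) * (a : CuntzAlgebra n) * cuntzGen i, star_gen_conj_mem i a⟩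

/-! ### Hilbert bimodules, Pimsner–Popa bases and indices -/

/-- Positivity in a C*-algebra. -/
def IsPositiveElem {A : Type*} [CStarAlgebra A] (a : A) : Prop := ∃ b : A, a = star b * b

/-- The operations of an `A`-`B` bimodule `X` with two algebra-valued inner products. -/
structure BimoduleData (A B X : Type*) where
  /-- the left action `a ▷ ξ` -/
  lact : A → X → X
  /-- the right action `ξ ◁ b` -/
  ract : X → B → X
  /-- the left inner product `_A⟨ξ, η⟩`, linear in the first variable -/
  linner : X → X → A
  /-- the right inner product `⟨ξ | η⟩_B`, linear in the second variable -/
  rinner : X → X → B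

namespace BimoduleData

variable {A B X : Type*} [CStarAlgebra A] [CStarAlgebra B] [AddCommGroup X] [Module ℂ X]

/-- `X` is a left Hilbert `A`-module. Completeness is with respect to the norm
`‖ξ‖² = ‖_A⟨ξ, ξ⟩‖`. -/
structure IsLeftHilbertModule (D : BimoduleData A B X) : Prop where
  lact_add : ∀ a ξ η, D.lact a (ξ + η) = D.lact a ξ + D.lact a η
  add_lact : ∀ a a' ξ, D.lact (a + a') ξ = D.lact a ξ + D.lact a' ξ
  smul_lact : ∀ (c : ℂ) a ξ, D.lact (c • a) ξ = c • D.lact a ξ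
  lact_smul : ∀ (c : ℂ) a ξ, D.lact a (c • ξ) = c • D.lact a ξ
  one_lact : ∀ ξ, D.lact 1 ξ = ξ
  mul_lact : ∀ a a' ξ, D.lact (a * a') ξ = D.lact a (D.lact a' ξ)
  linner_add : ∀ ξ ξ' η, D.linner (ξ + ξ') η = D.linner ξ η + D.linner ξ' η
  linner_smul : ∀ (c : ℂ) ξ η, D.linner (c • ξ) η = c • D.linner ξ η
  linner_lact : ∀ a ξ η, D.linner (D.lact a ξ) η = a * D.linner ξ η
  star_linner : ∀ ξ η, star (D.linner ξ η) = D.linner η ξ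
  linner_pos : ∀ ξ, IsPositiveElem (D.linner ξ ξ)
  linner_definite : ∀ ξ, D.linner ξ ξ = 0 → ξ = 0
  complete : ∀ u : ℕ → X,
    (∀ ε : ℝ, 0 < ε → ∃ N, ∀ m k, N ≤ m → N ≤ k → ‖D.linner (u m - u k) (u m - u k)‖ < ε) →
    ∃ ξ, Filter.Tendsto (fun m => ‖D.linner (u m - ξ) (u m - ξ)‖) Filter.atTop (𝓝 0)

/-- `X` is a right Hilbert `B`-module. Completeness is with respect to the norm
`‖ξ‖² = ‖⟨ξ | ξ⟩_B‖`. -/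
structure IsRightHilbertModule (D : BimoduleData A B X) : Prop where
  add_ract : ∀ ξ η b, D.ract (ξ + η) b = D.ract ξ b + D.ract η b
  ract_add : ∀ ξ b b', D.ract ξ (b + b') = D.ract ξ b + D.ract ξ b'
  ract_smul : ∀ (c : ℂ) ξ b, D.ract ξ (c • b) = c • D.ract ξ b
  smul_ract : ∀ (c : ℂ) ξ b, D.ract (c • ξ) b = c • D.ract ξ b
  ract_one : ∀ ξ, D.ract ξ 1 = ξ
  ract_mul : ∀ ξ b b', D.ract ξ (b * b') = D.ract (D.ract ξ b) b'
  rinner_add : ∀ ξ η η', D.rinner ξ (η + η') = D.rinner ξ η + D.rinner ξ η'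
  rinner_smul : ∀ (c : ℂ) ξ η, D.rinner ξ (c • η) = c • D.rinner ξ η
  rinner_ract : ∀ ξ η b, D.rinner ξ (D.ract η b) = D.rinner ξ η * b
  star_rinner : ∀ ξ η, star (D.rinner ξ η) = D.rinner η ξ
  rinner_pos : ∀ ξ, IsPositiveElem (D.rinner ξ ξ)
  rinner_definite : ∀ ξ, D.rinner ξ ξ = 0 → ξ = 0
  complete : ∀ u : ℕ → X,
    (∀ ε : ℝ, 0 < ε → ∃ N, ∀ m k, N ≤ m → N ≤ k → ‖D.rinner (u m - u k) (u m - u k)‖ < ε) →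
    ∃ ξ, Filter.Tendsto (fun m => ‖D.rinner (u m - ξ) (u m - ξ)‖) Filter.atTop (𝓝 0)

/-- `X` is a Hilbert `A`-`B` bimodule: a left Hilbert `A`-module and a right Hilbert `B`-module
with commuting actions, each algebra acting by adjointable operators for the inner product with
values in the other one, and with equivalent left and right norms. -/
structure IsHilbertBimodule (D : BimoduleData A B X) : Prop where
  left : D.IsLeftHilbertModule
  right : D.IsRightHilbertModule
  lact_ract : ∀ a ξ b, D.ract (D.lact a ξ) b = D.lact a (D.ract ξ b)
  linner_ract : ∀ ξ η b, D.linner ξ (D.ract η b) = D.linner (D.ract ξ (star b)) η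
  rinner_lact : ∀ a ξ η, D.rinner ξ (D.lact a η) = D.rinner (D.lact (star a) ξ) η
  norm_equiv : ∃ C : ℝ, ∀ ξ,
    ‖D.linner ξ ξ‖ ≤ C * ‖D.rinner ξ ξ‖ ∧ ‖D.rinner ξ ξ‖ ≤ C * ‖D.linner ξ ξ‖

/-- A finite left Pimsner–Popa basis: `ξ = ∑ _A⟨ξ, u_i⟩ ▷ u_i` for all `ξ`. -/
def IsLeftBasis (D : BimoduleData A B X) {ι : Type*} [Fintype ι] (u : ι → X) : Prop :=
  ∀ ξ, ∑ i, D.lact (D.linner ξ (u i)) (u i) = ξ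

/-- A finite right Pimsner–Popa basis: `ξ = ∑ u_i ◁ ⟨u_i | ξ⟩_B` for all `ξ`. -/
def IsRightBasis (D : BimoduleData A B X) {ι : Type*} [Fintype ι] (u : ι → X) : Prop :=
  ∀ ξ, ∑ i, D.ract (u i) (D.rinner (u i) ξ) = ξ

/-- Finitely generated projective Hilbert bimodules: those with finite left and right
Pimsner–Popa bases. -/
structure IsFGP (D : BimoduleData A B X) : Prop where
  isHilbertBimodule : D.IsHilbertBimodule
  exists_leftBasis : ∃ (m : ℕ) (u : Fin m → X), D.IsLeftBasis u
  exists_rightBasis : ∃ (m : ℕ) (u : Fin m → X), D.IsRightBasis u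

/-- The left index is `∑ ⟨u_i | u_i⟩_B` for a finite left Pimsner–Popa basis `u`: there is such a
basis, and every such basis gives the value `b`. -/
def HasLeftIndex (D : BimoduleData A B X) (b : B) : Prop :=
  (∃ (m : ℕ) (u : Fin m → X), D.IsLeftBasis u) ∧
    ∀ (m : ℕ) (u : Fin m → X), D.IsLeftBasis u → ∑ i, D.rinner (u i) (u i) = b

/-- The right index is `∑ _A⟨v_i, v_i⟩` for a finite right Pimsner–Popa basis `v`: there is such a
basis, and every such basis gives the value `a`. -/
def HasRightIndex (D : BimoduleData A B X) (a : A) : Prop :=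
  (∃ (m : ℕ) (v : Fin m → X), D.IsRightBasis v) ∧
    ∀ (m : ℕ) (v : Fin m → X), D.IsRightBasis v → ∑ i, D.linner (v i) (v i) = a

/-- The Watatani index of an `A`-`A` bimodule is the product of its right and left indices. -/
def HasWatataniIndex (D : BimoduleData A A X) (c : A) : Prop :=
  ∃ r l : A, D.HasRightIndex r ∧ D.HasLeftIndex l ∧ c = r * l

end BimoduleData

/-- The bimodule `_λA_A` over the core `A` of `O_n`: the space is `A`, with left action
`a ▷ ξ = λ(a) ξ`, right action `ξ ◁ a = ξ a`, left inner product `_A⟨η, ξ⟩ = ℒ(ℰ(η ξ^*))` and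
right inner product `⟨η | ξ⟩_A = η^* ξ`. -/
def lambdaBimodule (n : ℕ) : BimoduleData (Core n) (Core n) (Core n) where
  lact a ξ := coreEndo a * ξ
  ract ξ a := ξ * a
  linner η ξ := coreTransfer (coreExp (η * star ξ))
  rinner η ξ := star η * ξ

end

/-!
The maps `coreEndo` and `coreTransfer` are `λ(a) = ∑ s_i a s_i^*` and `ℒ(a) = ∑ s_i^* a s_i`, and the
Cuntz relations give `ℒ ∘ ℰ = ℒ` and `ℒ(λ(a) b) = a ℒ(b)`. So the left inner product is
`_A⟨η, ξ⟩ = ∑ s_k^* η ξ^* s_k`, and all algebraic bimodule axioms are computations with the relations.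

Positivity has to be witnessed inside the core: inserting `∑ s_j s_j^* = 1` gives
`s_k^* ξ ξ^* s_k = ∑_j (s_j^* ξ^* s_k)^* (s_j^* ξ^* s_k)`, where `s_j^* ξ^* s_k` is gauge invariant.
The analytic axioms come from the norm equivalence
`‖_A⟨ξ, ξ⟩‖ ≤ n ‖ξ‖²` and `‖ξ‖² ≤ n² ‖_A⟨ξ, ξ⟩‖`. The second bound holds because
`ξ = ∑ s_k s_k^* ξ` and `‖s_k^* ξ‖² = ‖s_k^* ξ ξ^* s_k‖ ≤ ‖_A⟨ξ, ξ⟩‖`; it makes the left inner product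
definite and transfers completeness from the norm of the core.

The indices do not depend on the basis in any Hilbert bimodule: expanding the elements of one basis
in another and moving the coefficients across by adjointability exchanges the two bases. Hence
they may be computed in the bases `s_i s_j^*` and `1`.
-/

/-! ### Independence of the indices from the basis -/

namespace BimoduleData

variable {A B X : Type*} [CStarAlgebra A] [CStarAlgebra B] [AddCommGroup X] [Module ℂ X]
  {D : BimoduleData A B X}

omit [CStarAlgebra A] in
theorem IsRightHilbertModule.rinner_sum (h : D.IsRightHilbertModule) {ι : Type*} (s : Finset ι)
    (ξ : X) (f : ι → X) : D.rinner ξ (∑ i ∈ s, f i) = ∑ i ∈ s, D.rinner ξ (f i) :=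
  map_sum (AddMonoidHom.mk' (D.rinner ξ) (h.rinner_add ξ)) f s

omit [CStarAlgebra A] in
theorem IsRightHilbertModule.sum_rinner (h : D.IsRightHilbertModule) {ι : Type*} (s : Finset ι)
    (f : ι → X) (ξ : X) : D.rinner (∑ i ∈ s, f i) ξ = ∑ i ∈ s, D.rinner (f i) ξ := by
  simp_rw [← h.star_rinner ξ, h.rinner_sum, star_sum]

omit [CStarAlgebra B] in
theorem IsLeftHilbertModule.sum_linner (h : D.IsLeftHilbertModule) {ι : Type*} (s : Finset ι)
    (f : ι → X) (ξ : X) : D.linner (∑ i ∈ s, f i) ξ = ∑ i ∈ s, D.linner (f i) ξ :=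
  map_sum (AddMonoidHom.mk' (D.linner · ξ) (h.linner_add · · ξ)) f s

omit [CStarAlgebra B] in
theorem IsLeftHilbertModule.linner_sum (h : D.IsLeftHilbertModule) {ι : Type*} (s : Finset ι)
    (ξ : X) (f : ι → X) : D.linner ξ (∑ i ∈ s, f i) = ∑ i ∈ s, D.linner ξ (f i) := by
  simp_rw [← h.star_linner _ ξ, h.sum_linner, star_sum]

theorem IsHilbertBimodule.sum_rinner_eq_of_isLeftBasis (h : D.IsHilbertBimodule) {ι κ : Type*}
    [Fintype ι] [Fintype κ] {u : ι → X} {v : κ → X} (hu : D.IsLeftBasis u)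
    (hv : D.IsLeftBasis v) : ∑ i, D.rinner (u i) (u i) = ∑ j, D.rinner (v j) (v j) := by
  calc ∑ i, D.rinner (u i) (u i)
      = ∑ i, ∑ j, D.rinner (u i) (D.lact (D.linner (u i) (v j)) (v j)) := by
        refine Finset.sum_congr rfl fun i _ => ?_
        rw [← h.right.rinner_sum, hv]
    _ = ∑ j, ∑ i, D.rinner (D.lact (D.linner (v j) (u i)) (u i)) (v j) := by
        rw [Finset.sum_comm]
        simp_rw [h.rinner_lact, h.left.star_linner]
    _ = ∑ j, D.rinner (v j) (v j) := by
        refine Finset.sum_congr rfl fun j _ => ?_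
        rw [← h.right.sum_rinner, hu]

theorem IsHilbertBimodule.sum_linner_eq_of_isRightBasis (h : D.IsHilbertBimodule) {ι κ : Type*}
    [Fintype ι] [Fintype κ] {u : ι → X} {v : κ → X} (hu : D.IsRightBasis u)
    (hv : D.IsRightBasis v) : ∑ i, D.linner (u i) (u i) = ∑ j, D.linner (v j) (v j) := by
  calc ∑ i, D.linner (u i) (u i)
      = ∑ i, ∑ j, D.linner (u i) (D.ract (v j) (D.rinner (v j) (u i))) := by
        refine Finset.sum_congr rfl fun i _ => ?_
        rw [← h.left.linner_sum, hv]
    _ = ∑ j, ∑ i, D.linner (D.ract (u i) (D.rinner (u i) (v j))) (v j) := by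
        rw [Finset.sum_comm]
        simp_rw [h.linner_ract, h.right.star_rinner]
    _ = ∑ j, D.linner (v j) (v j) := by
        refine Finset.sum_congr rfl fun j _ => ?_
        rw [← h.left.sum_linner, hu]

omit [CStarAlgebra A] [CStarAlgebra B] [Module ℂ X] in
theorem IsLeftBasis.exists_fin {ι : Type*} [Fintype ι] {u : ι → X} (hu : D.IsLeftBasis u) :
    ∃ (m : ℕ) (v : Fin m → X), D.IsLeftBasis v := by
  refine ⟨Fintype.card ι, u ∘ (Fintype.equivFin ι).symm, fun ξ => ?_⟩
  exact ((Fintype.equivFin ι).symm.sum_comp _).trans (hu ξ)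

omit [CStarAlgebra A] [CStarAlgebra B] [Module ℂ X] in
theorem IsRightBasis.exists_fin {ι : Type*} [Fintype ι] {u : ι → X} (hu : D.IsRightBasis u) :
    ∃ (m : ℕ) (v : Fin m → X), D.IsRightBasis v := by
  refine ⟨Fintype.card ι, u ∘ (Fintype.equivFin ι).symm, fun ξ => ?_⟩
  exact ((Fintype.equivFin ι).symm.sum_comp _).trans (hu ξ)

theorem IsHilbertBimodule.hasLeftIndex (h : D.IsHilbertBimodule) {ι : Type*} [Fintype ι]
    {u : ι → X} (hu : D.IsLeftBasis u) : D.HasLeftIndex (∑ i, D.rinner (u i) (u i)) :=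
  ⟨hu.exists_fin, fun _ _ hv => h.sum_rinner_eq_of_isLeftBasis hv hu⟩

theorem IsHilbertBimodule.hasRightIndex (h : D.IsHilbertBimodule) {ι : Type*} [Fintype ι]
    {u : ι → X} (hu : D.IsRightBasis u) : D.HasRightIndex (∑ i, D.linner (u i) (u i)) :=
  ⟨hu.exists_fin, fun _ _ hv => h.sum_linner_eq_of_isRightBasis hv hu⟩

end BimoduleData

/-! ### Positive elements -/

theorem isPositiveElem_sum {A ι : Type*} [CStarAlgebra A] (s : Finset ι) (b : ι → A) :
    IsPositiveElem (∑ i ∈ s, star (b i) * b i) := by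
  -- The order of a C*-algebra is not a global instance; in it the positive elements are `b^* b`.
  let _ := CStarAlgebra.spectralOrder A
  have _ := CStarAlgebra.spectralOrderedRing A
  exact CStarAlgebra.nonneg_iff_eq_star_mul_self.1
    (Finset.sum_nonneg fun i _ => star_mul_self_nonneg (b i))

theorem norm_sq_le_norm_sum_star_mul_self {A ι : Type*} [CStarAlgebra A] {s : Finset ι}
    (b : ι → A) {i : ι} (hi : i ∈ s) : ‖b i‖ ^ 2 ≤ ‖∑ j ∈ s, star (b j) * b j‖ := by
  let _ := CStarAlgebra.spectralOrder A
  have _ := CStarAlgebra.spectralOrderedRing A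
  rw [sq, ← CStarRing.norm_star_mul_self]
  exact CStarAlgebra.norm_le_norm_of_nonneg_of_le (star_mul_self_nonneg _)
    (Finset.single_le_sum (f := fun j => star (b j) * b j)
      (fun j _ => star_mul_self_nonneg (b j)) hi)

/-! ### Computations with the Cuntz relations -/

namespace IsCuntzFamily

variable {n : ℕ} {C : Type*} [CStarAlgebra C] {s : Fin n → C}

theorem star_mul_mul (h : IsCuntzFamily s) (i j : Fin n) (x : C) :
    star (s i) * (s j * x) = if i = j then x else 0 := by
  rw [← mul_assoc, h.star_mul, ite_mul, one_mul, zero_mul]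

theorem sum_mul_star_mul (h : IsCuntzFamily s) (x : C) : ∑ i, s i * (star (s i) * x) = x := by
  simp_rw [← mul_assoc, ← Finset.sum_mul, h.sum_mul_star, one_mul]

/-- Unlike `IsCuntzFamily.norm_le_one`, this covers the zero algebra. -/
theorem norm_gen_le_one (h : IsCuntzFamily s) (i : Fin n) : ‖s i‖ ≤ 1 := by
  rcases subsingleton_or_nontrivial C with hC | hC
  · rw [Subsingleton.elim (s i) 0, norm_zero]
    exact zero_le_one
  · exact h.norm_le_one i

theorem norm_sum_conj_le (h : IsCuntzFamily s) (x : C) :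
    ‖∑ k, star (s k) * x * s k‖ ≤ n * ‖x‖ := by
  calc ‖∑ k, star (s k) * x * s k‖ ≤ ∑ _k : Fin n, ‖x‖ := by
        refine norm_sum_le_of_le _ fun k _ => ?_
        have hk := h.norm_gen_le_one k
        calc ‖star (s k) * x * s k‖ ≤ ‖star (s k)‖ * ‖x‖ * ‖s k‖ := norm_mul₃_le
          _ ≤ 1 * ‖x‖ * 1 := by rw [norm_star]; gcongr
          _ = ‖x‖ := by ring
    _ = n * ‖x‖ := by simp

theorem norm_sq_le_norm_sum_conj (h : IsCuntzFamily s) (x : C) :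
    ‖x‖ ^ 2 ≤ n ^ 2 * ‖∑ k, star (s k) * (x * star x) * s k‖ := by
  have hform : ∑ k, star (s k) * (x * star x) * s k
      = ∑ k, star (star x * s k) * (star x * s k) := by
    simp only [StarMul.star_mul, star_star, mul_assoc]
  have hx : ‖x‖ ≤ ∑ _k : Fin n, √‖∑ k, star (s k) * (x * star x) * s k‖ := by
    conv_lhs => rw [← h.sum_mul_star_mul x]
    refine norm_sum_le_of_le _ fun k _ => ?_
    have hk : ‖s k * (star (s k) * x)‖ ≤ ‖star x * s k‖ := by
      calc ‖s k * (star (s k) * x)‖ ≤ ‖s k‖ * ‖star (s k) * x‖ := norm_mul_le _ _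
        _ ≤ 1 * ‖star (s k) * x‖ := by gcongr; exact h.norm_gen_le_one k
        _ = ‖star x * s k‖ := by rw [one_mul, ← norm_star, StarMul.star_mul, star_star]
    refine hk.trans (Real.le_sqrt_of_sq_le ?_)
    rw [hform]
    exact norm_sq_le_norm_sum_star_mul_self (fun k => star x * s k) (Finset.mem_univ k)
  rw [Finset.sum_const, Finset.card_univ, Fintype.card_fin, nsmul_eq_mul] at hx
  calc ‖x‖ ^ 2 ≤ (n * √‖∑ k, star (s k) * (x * star x) * s k‖) ^ 2 := by gcongr
    _ = _ := by rw [mul_pow, Real.sq_sqrt (norm_nonneg _)]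

end IsCuntzFamily

/-! ### The maps `λ` and `ℒ` on the core -/

section Core

variable {n : ℕ}

theorem coe_coreUnit (i j : Fin n) :
    (coreUnit i j : CuntzAlgebra n) = cuntzGen i * star (cuntzGen j) := rfl

theorem coe_coreEndo (a : Core n) :
    (coreEndo a : CuntzAlgebra n) = ∑ i, cuntzGen i * (a : CuntzAlgebra n) * star (cuntzGen i) := by
  rw [coreEndo, AddSubmonoidClass.coe_finsetSum]

theorem coe_coreTransfer (a : Core n) :
    (coreTransfer a : CuntzAlgebra n)
      = ∑ i, star (cuntzGen i) * (a : CuntzAlgebra n) * cuntzGen i := by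
  rw [coreTransfer, AddSubmonoidClass.coe_finsetSum]

theorem coreTransfer_coreExp (a : Core n) : coreTransfer (coreExp a) = coreTransfer a := by
  have h := isCuntzFamily_cuntzGen n
  apply Subtype.ext
  rw [coe_coreTransfer, coe_coreTransfer, coreExp, AddSubmonoidClass.coe_finsetSum]
  refine Finset.sum_congr rfl fun k _ => ?_
  simp only [MulMemClass.coe_mul, coe_coreUnit, Finset.mul_sum, Finset.sum_mul, mul_assoc,
    h.star_mul_mul, h.star_mul, mul_ite, mul_one, mul_zero, ite_mul, zero_mul]
  simp

theorem coreEndo_add (a b : Core n) : coreEndo (a + b) = coreEndo a + coreEndo b := by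
  apply Subtype.ext
  simp only [coe_coreEndo, AddMemClass.coe_add, mul_add, add_mul, Finset.sum_add_distrib]

theorem coreEndo_smul (c : ℂ) (a : Core n) : coreEndo (c • a) = c • coreEndo a := by
  apply Subtype.ext
  simp only [coe_coreEndo, SetLike.val_smul, mul_smul_comm, smul_mul_assoc, Finset.smul_sum]

theorem coreEndo_one : coreEndo (1 : Core n) = 1 := by
  apply Subtype.ext
  simp only [coe_coreEndo, OneMemClass.coe_one, mul_one, (isCuntzFamily_cuntzGen n).sum_mul_star]

theorem coreEndo_mul (a b : Core n) : coreEndo (a * b) = coreEndo a * coreEndo b := by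
  apply Subtype.ext
  simp only [coe_coreEndo, MulMemClass.coe_mul, Finset.sum_mul, Finset.mul_sum, mul_assoc,
    (isCuntzFamily_cuntzGen n).star_mul_mul, mul_ite, mul_zero]
  simp

theorem coreEndo_star (a : Core n) : coreEndo (star a) = star (coreEndo a) := by
  apply Subtype.ext
  simp only [coe_coreEndo, StarMemClass.coe_star, star_sum, star_mul, star_star, mul_assoc]

theorem coreTransfer_add (a b : Core n) :
    coreTransfer (a + b) = coreTransfer a + coreTransfer b := by
  apply Subtype.ext
  simp only [coe_coreTransfer, AddMemClass.coe_add, mul_add, add_mul, Finset.sum_add_distrib]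

theorem coreTransfer_smul (c : ℂ) (a : Core n) : coreTransfer (c • a) = c • coreTransfer a := by
  apply Subtype.ext
  simp only [coe_coreTransfer, SetLike.val_smul, mul_smul_comm, smul_mul_assoc, Finset.smul_sum]

theorem coreTransfer_star (a : Core n) : coreTransfer (star a) = star (coreTransfer a) := by
  apply Subtype.ext
  simp only [coe_coreTransfer, StarMemClass.coe_star, star_sum, star_mul, star_star, mul_assoc]

theorem coreTransfer_coreEndo_mul (a b : Core n) :
    coreTransfer (coreEndo a * b) = a * coreTransfer b := by
  apply Subtype.ext
  simp only [coe_coreTransfer, coe_coreEndo, MulMemClass.coe_mul, Finset.sum_mul, Finset.mul_sum,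
    mul_assoc, (isCuntzFamily_cuntzGen n).star_mul_mul]
  simp [mul_assoc]

theorem coreTransfer_one : coreTransfer (1 : Core n) = n := by
  apply Subtype.ext
  simp [coe_coreTransfer, (isCuntzFamily_cuntzGen n).star_mul]

theorem star_gen_mul_mul_gen_mem (i j : Fin n) (a : Core n) :
    star (cuntzGen i) * (a : CuntzAlgebra n) * cuntzGen j ∈ cuntzCore n := by
  intro z
  have hz : star (z : ℂ) * (z : ℂ) = 1 := by
    rw [Complex.star_def, ← Complex.normSq_eq_conj_mul_self, Circle.normSq_coe, Complex.ofReal_one]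
  rw [map_mul, map_mul, map_star, cuntzGauge_gen, cuntzGauge_gen, a.2 z, star_smul, smul_mul_assoc,
    smul_mul_smul_comm, hz, one_smul]

/-- The element `s_i^* a s_j` of the core. -/
noncomputable def coreCompression (i j : Fin n) (a : Core n) : Core n :=
  ⟨star (cuntzGen i) * (a : CuntzAlgebra n) * cuntzGen j, star_gen_mul_mul_gen_mem i j a⟩

theorem coe_coreCompression (i j : Fin n) (a : Core n) :
    (coreCompression i j a : CuntzAlgebra n)
      = star (cuntzGen i) * (a : CuntzAlgebra n) * cuntzGen j := rfl

theorem coreTransfer_mul_star_self (ξ : Core n) :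
    coreTransfer (ξ * star ξ) = ∑ p : Fin n × Fin n,
      star (coreCompression p.2 p.1 (star ξ)) * coreCompression p.2 p.1 (star ξ) := by
  have h := isCuntzFamily_cuntzGen n
  apply Subtype.ext
  rw [coe_coreTransfer, AddSubmonoidClass.coe_finsetSum, Fintype.sum_prod_type]
  refine Finset.sum_congr rfl fun k _ => ?_
  simp only [MulMemClass.coe_mul, StarMemClass.coe_star, coe_coreCompression, star_mul, star_star,
    mul_assoc, ← Finset.mul_sum, h.sum_mul_star_mul]

theorem coreTransfer_mul_coreUnit (ξ : Core n) (i j : Fin n) :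
    coreTransfer (ξ * star (coreUnit i j)) = coreCompression i j ξ := by
  apply Subtype.ext
  simp only [coe_coreTransfer, MulMemClass.coe_mul, StarMemClass.coe_star, coe_coreUnit, star_mul,
    star_star, mul_assoc, coe_coreCompression, (isCuntzFamily_cuntzGen n).star_mul, mul_ite,
    mul_one, mul_zero]
  simp

theorem coreEndo_coreCompression_mul_coreUnit (ξ : Core n) (i j : Fin n) :
    coreEndo (coreCompression i j ξ) * coreUnit i j = coreUnit i i * ξ * coreUnit j j := by
  apply Subtype.ext
  simp only [coe_coreEndo, MulMemClass.coe_mul, coe_coreUnit, mul_assoc, coe_coreCompression,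
    (isCuntzFamily_cuntzGen n).star_mul_mul, mul_ite, mul_zero, Finset.sum_mul]
  simp

theorem sum_coreUnit_self : ∑ i : Fin n, coreUnit i i = 1 := by
  apply Subtype.ext
  rw [AddSubmonoidClass.coe_finsetSum]
  exact (isCuntzFamily_cuntzGen n).sum_mul_star

theorem star_coreUnit_mul_self (i j : Fin n) :
    star (coreUnit i j) * coreUnit i j = coreUnit j j := by
  apply Subtype.ext
  simp [coe_coreUnit, mul_assoc, (isCuntzFamily_cuntzGen n).star_mul_mul]

theorem norm_coreTransfer_le (a : Core n) : ‖coreTransfer a‖ ≤ n * ‖a‖ := by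
  have h := (isCuntzFamily_cuntzGen n).norm_sum_conj_le (a : CuntzAlgebra n)
  rwa [← coe_coreTransfer] at h

theorem norm_sq_le_norm_coreTransfer (ξ : Core n) :
    ‖ξ‖ ^ 2 ≤ n ^ 2 * ‖coreTransfer (ξ * star ξ)‖ := by
  have h := (isCuntzFamily_cuntzGen n).norm_sq_le_norm_sum_conj (ξ : CuntzAlgebra n)
  have h2 := coe_coreTransfer (ξ * star ξ)
  rw [MulMemClass.coe_mul, StarMemClass.coe_star] at h2
  rwa [← h2] at h

end Core

/-! ### The bimodule `_λA_A` -/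

/-- Completeness for a function `q` dominating, and dominated by, multiples of the squared norm. -/
theorem exists_tendsto_of_sq_norm_equiv {E : Type*} [NormedAddCommGroup E] [CompleteSpace E]
    {q : E → ℝ} {c C : ℝ} (hq : ∀ x, 0 ≤ q x) (hle : ∀ x, q x ≤ c * ‖x‖ ^ 2)
    (hge : ∀ x, ‖x‖ ^ 2 ≤ C * q x) (u : ℕ → E)
    (hu : ∀ ε : ℝ, 0 < ε → ∃ N, ∀ m k, N ≤ m → N ≤ k → q (u m - u k) < ε) :
    ∃ x, Filter.Tendsto (fun m => q (u m - x)) Filter.atTop (𝓝 0) := by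
  have hcau : CauchySeq u := by
    rw [Metric.cauchySeq_iff]
    intro ε hε
    obtain ⟨N, hN⟩ := hu (ε ^ 2 / (|C| + 1)) (by positivity)
    refine ⟨N, fun m hm k hk => ?_⟩
    rw [dist_eq_norm]
    refine lt_of_pow_lt_pow_left₀ 2 hε.le ?_
    calc ‖u m - u k‖ ^ 2 ≤ C * q (u m - u k) := hge _
      _ ≤ (|C| + 1) * q (u m - u k) := by
        gcongr
        · exact hq _
        · linarith [le_abs_self C]
      _ < (|C| + 1) * (ε ^ 2 / (|C| + 1)) := by
        gcongr
        exact hN m k hm hk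
      _ = ε ^ 2 := by field_simp
  obtain ⟨x, hx⟩ := cauchySeq_tendsto_of_complete hcau
  refine ⟨x, squeeze_zero (fun m => hq _) (fun m => hle _) ?_⟩
  have h0 : Filter.Tendsto (fun m => ‖u m - x‖) Filter.atTop (𝓝 0) :=
    tendsto_iff_norm_sub_tendsto_zero.1 hx
  simpa using (h0.pow 2).const_mul c

section Lambda

variable (n : ℕ)

theorem lambdaBimodule_lact (a ξ : Core n) : (lambdaBimodule n).lact a ξ = coreEndo a * ξ := rfl

theorem lambdaBimodule_ract (ξ a : Core n) : (lambdaBimodule n).ract ξ a = ξ * a := rfl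

theorem lambdaBimodule_linner (ξ η : Core n) :
    (lambdaBimodule n).linner ξ η = coreTransfer (ξ * star η) :=
  coreTransfer_coreExp _

theorem lambdaBimodule_rinner (ξ η : Core n) : (lambdaBimodule n).rinner ξ η = star ξ * η := rfl

theorem norm_lambdaBimodule_rinner_self (ξ : Core n) :
    ‖(lambdaBimodule n).rinner ξ ξ‖ = ‖ξ‖ ^ 2 := by
  rw [lambdaBimodule_rinner, CStarRing.norm_star_mul_self, sq]

theorem norm_lambdaBimodule_linner_self_le (ξ : Core n) :
    ‖(lambdaBimodule n).linner ξ ξ‖ ≤ n * ‖ξ‖ ^ 2 := by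
  rw [lambdaBimodule_linner, sq, ← CStarRing.norm_self_mul_star]
  exact norm_coreTransfer_le _

theorem norm_sq_le_norm_lambdaBimodule_linner_self (ξ : Core n) :
    ‖ξ‖ ^ 2 ≤ n ^ 2 * ‖(lambdaBimodule n).linner ξ ξ‖ := by
  rw [lambdaBimodule_linner]
  exact norm_sq_le_norm_coreTransfer ξ

theorem isLeftHilbertModule_lambdaBimodule : (lambdaBimodule n).IsLeftHilbertModule where
  lact_add _ _ _ := mul_add _ _ _
  add_lact a a' ξ := by simp only [lambdaBimodule_lact, coreEndo_add, add_mul]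
  smul_lact c a ξ := by simp only [lambdaBimodule_lact, coreEndo_smul, smul_mul_assoc]
  lact_smul _ _ _ := mul_smul_comm _ _ _
  one_lact ξ := by rw [lambdaBimodule_lact, coreEndo_one, one_mul]
  mul_lact a a' ξ := by simp only [lambdaBimodule_lact, coreEndo_mul, mul_assoc]
  linner_add ξ ξ' η := by simp only [lambdaBimodule_linner, add_mul, coreTransfer_add]
  linner_smul c ξ η := by simp only [lambdaBimodule_linner, smul_mul_assoc, coreTransfer_smul]
  linner_lact a ξ η := by
    simp only [lambdaBimodule_linner, lambdaBimodule_lact, mul_assoc, coreTransfer_coreEndo_mul]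
  star_linner ξ η := by
    simp only [lambdaBimodule_linner, ← coreTransfer_star, star_mul, star_star]
  linner_pos ξ := by
    rw [lambdaBimodule_linner, coreTransfer_mul_star_self]
    exact isPositiveElem_sum _ _
  linner_definite ξ h := by
    have h1 := norm_sq_le_norm_lambdaBimodule_linner_self n ξ
    rw [h, norm_zero, mul_zero] at h1
    exact norm_eq_zero.1 (pow_eq_zero_iff two_ne_zero |>.1 (h1.antisymm (sq_nonneg _)))
  complete := exists_tendsto_of_sq_norm_equiv (fun _ => norm_nonneg _)
    (norm_lambdaBimodule_linner_self_le n) (norm_sq_le_norm_lambdaBimodule_linner_self n)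

theorem isRightHilbertModule_lambdaBimodule : (lambdaBimodule n).IsRightHilbertModule where
  add_ract _ _ _ := add_mul _ _ _
  ract_add _ _ _ := mul_add _ _ _
  ract_smul _ _ _ := mul_smul_comm _ _ _
  smul_ract _ _ _ := smul_mul_assoc _ _ _
  ract_one _ := mul_one _
  ract_mul _ _ _ := (mul_assoc _ _ _).symm
  rinner_add _ _ _ := mul_add _ _ _
  rinner_smul _ _ _ := mul_smul_comm _ _ _
  rinner_ract _ _ _ := (mul_assoc _ _ _).symm
  star_rinner ξ η := by simp only [lambdaBimodule_rinner, star_mul, star_star]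
  rinner_pos ξ := ⟨ξ, rfl⟩
  rinner_definite ξ h := CStarRing.star_mul_self_eq_zero_iff ξ |>.1 h
  complete := exists_tendsto_of_sq_norm_equiv (c := 1) (C := 1)
    (q := fun ξ : Core n => ‖(lambdaBimodule n).rinner ξ ξ‖) (fun _ => norm_nonneg _)
    (fun ξ : Core n => by rw [norm_lambdaBimodule_rinner_self, one_mul])
    (fun ξ : Core n => by rw [norm_lambdaBimodule_rinner_self, one_mul])

theorem isHilbertBimodule_lambdaBimodule : (lambdaBimodule n).IsHilbertBimodule where
  left := isLeftHilbertModule_lambdaBimodule n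
  right := isRightHilbertModule_lambdaBimodule n
  lact_ract _ _ _ := mul_assoc _ _ _
  linner_ract ξ η b := by
    simp only [lambdaBimodule_linner, lambdaBimodule_ract, star_mul, mul_assoc]
  rinner_lact a ξ η := by
    simp only [lambdaBimodule_rinner, lambdaBimodule_lact, star_mul, coreEndo_star, star_star,
      mul_assoc]
  norm_equiv := by
    refine ⟨n ^ 2, fun ξ => ?_⟩
    rw [norm_lambdaBimodule_rinner_self]
    refine ⟨(norm_lambdaBimodule_linner_self_le n ξ).trans ?_,
      norm_sq_le_norm_lambdaBimodule_linner_self n ξ⟩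
    gcongr
    exact_mod_cast Nat.le_self_pow two_ne_zero n

theorem isLeftBasis_coreUnit :
    (lambdaBimodule n).IsLeftBasis (fun p : Fin n × Fin n => coreUnit p.1 p.2) := by
  intro ξ
  simp only [lambdaBimodule_lact, lambdaBimodule_linner, coreTransfer_mul_coreUnit,
    coreEndo_coreCompression_mul_coreUnit]
  rw [Fintype.sum_prod_type]
  simp only [← Finset.mul_sum, sum_coreUnit_self, mul_one, ← Finset.sum_mul, one_mul]

theorem isRightBasis_one : (lambdaBimodule n).IsRightBasis (fun _ : Unit => (1 : Core n)) := by
  intro ξ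
  simp [lambdaBimodule_ract, lambdaBimodule_rinner]

theorem hasLeftIndex_lambdaBimodule : (lambdaBimodule n).HasLeftIndex (n : Core n) := by
  convert (isHilbertBimodule_lambdaBimodule n).hasLeftIndex (isLeftBasis_coreUnit n)
  simp only [lambdaBimodule_rinner, star_coreUnit_mul_self]
  simp [Fintype.sum_prod_type, sum_coreUnit_self]

theorem hasRightIndex_lambdaBimodule : (lambdaBimodule n).HasRightIndex (n : Core n) := by
  convert (isHilbertBimodule_lambdaBimodule n).hasRightIndex (isRightBasis_one n)
  simp [lambdaBimodule_linner, coreTransfer_one]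

end Lambda

theorem lemma3p2 (n : ℕ) (hn : 2 ≤ n) :
    (lambdaBimodule n).IsFGP ∧
    (lambdaBimodule n).IsLeftBasis (fun p : Fin n × Fin n => coreUnit p.1 p.2) ∧
    (lambdaBimodule n).IsRightBasis (fun _ : Unit => (1 : Core n)) ∧
    (lambdaBimodule n).HasLeftIndex (n : Core n) ∧
    (lambdaBimodule n).HasRightIndex (n : Core n) ∧
    (lambdaBimodule n).HasWatataniIndex ((n : Core n) ^ 2) :=
  ⟨⟨isHilbertBimodule_lambdaBimodule n, (isLeftBasis_coreUnit n).exists_fin,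
      (isRightBasis_one n).exists_fin⟩,
    isLeftBasis_coreUnit n, isRightBasis_one n, hasLeftIndex_lambdaBimodule n,
    hasRightIndex_lambdaBimodule n,
    n, n, hasRightIndex_lambdaBimodule n, hasLeftIndex_lambdaBimodule n, sq _⟩
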